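/- Consider the online graph partitioning problem with parameters $\ell,k\ge 1$. A graph has $\ell k$ vertices, each of volume $1/k$, and initially no edges; every vertex is initially assigned to one of $\ell$ servers so that each server holds exactly $k$ vertices (volume $1$). Edges are inserted one by one. After each edge insertion, the vertices of every connected component of the graph revealed so far must all be on the same server, and to achieve this vertices may be moved between servers at a cost of $1/k$ per moved vertex. An online algorithm decides on its moves knowing only the edges revealed so far and may place volume up to $1+\varepsilon$ (i.e. up to $(1+\varepsilon)k$ vertices) on each server. The optimal offline algorithm $\mathrm{OPT}$ knows the whole sequence in advance and may place volume at most $1$ (i.e. $k$ vertices) on each server; only edge sequences that can be served in this way are considered. Theorem. For every constant $\varepsilon>1$ (so that servers can hold $(2+\varepsilon')k$ vertices, where $\varepsilon'=\varepsilon-1>0$), there exists a deterministic online algorithm with strict competitive ratio $O(\log k)$. That is, there is a constant $C>0$ depending only on $\varepsilon$ such that for all $\ell,k\ge1$ and every initial assignment there is a deterministic online algorithm $\mathrm{ONL}$ that, on every such edge sequence, respects the above constraints after each insertion and satisfies $\operatorname{cost}(\mathrm{ONL})\le C\log k\cdot \operatorname{cost}(\mathrm{OPT})$. -/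

import Mathlib

namespace OnlineGraphPartitioning

/-- An assignment of the vertices to the `ℓ` servers. -/
abbrev Assignment (V : Type*) (ℓ : ℕ) := V → Fin ℓ

/-- The graph formed by the edges revealed in the request sequence `σ`. -/
def revealedGraph {V : Type*} (σ : List (Sym2 V)) : SimpleGraph V :=
  SimpleGraph.fromEdgeSet {e | e ∈ σ}

/-- The cc-condition: all vertices of a connected component of the revealed graph (a piece)
are on the same server. -/
def CCCondition {V : Type*} {ℓ : ℕ} (σ : List (Sym2 V)) (a : Assignment V ℓ) : Prop :=
  ∀ u v : V, (revealedGraph σ).Reachable u v → a u = a v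

/-- The volume of a set of vertices, each vertex having volume `1 / k`. -/
noncomputable def volume {V : Type*} (k : ℕ) (S : Finset V) : ℝ :=
  (S.card : ℝ) / (k : ℝ)

/-- Initially (under the source assignment) every server holds exactly `k` vertices. -/
def IsSourceAssignment {V : Type*} [Fintype V] {ℓ : ℕ} (k : ℕ) (src : Assignment V ℓ) : Prop :=
  ∀ s : Fin ℓ, (Finset.univ.filter fun v => src v = s).card = k

/-- `f t` is the assignment after the first `t` edge insertions of `σ`. The schedule `f` serves
`σ` with capacity `cap` if it starts with the source assignment and, after every edge insertion,
satisfies the cc-condition and puts volume at most `cap` on each server. -/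
structure Serves {V : Type*} [Fintype V] {ℓ : ℕ} (k : ℕ) (cap : ℝ) (src : Assignment V ℓ)
    (σ : List (Sym2 V)) (f : ℕ → Assignment V ℓ) : Prop where
  init : f 0 = src
  cc : ∀ t, 1 ≤ t → t ≤ σ.length → CCCondition (σ.take t) (f t)
  capacity : ∀ t, 1 ≤ t → t ≤ σ.length →
    ∀ s : Fin ℓ, volume k (Finset.univ.filter fun v => f t v = s) ≤ cap

/-- The total volume moved by the schedule `f` during the first `T` edge insertions. -/
noncomputable def cost {V : Type*} [Fintype V] {ℓ : ℕ} (k T : ℕ)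
    (f : ℕ → Assignment V ℓ) : ℝ :=
  ∑ t ∈ Finset.range T, volume k (Finset.univ.filter fun v => f (t + 1) v ≠ f t v)

/-- The request sequence can be served offline with volume at most `1` on every server. -/
def Feasible {V : Type*} [Fintype V] {ℓ : ℕ} (k : ℕ) (src : Assignment V ℓ)
    (σ : List (Sym2 V)) : Prop :=
  ∃ f : ℕ → Assignment V ℓ, Serves k 1 src σ f

/-- The cost of an optimal offline algorithm, which knows all of `σ` in advance and may put
volume at most `1` on every server. Only used for feasible `σ`. -/
noncomputable def optCost {V : Type*} [Fintype V] {ℓ : ℕ} (k : ℕ) (src : Assignment V ℓ)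
    (σ : List (Sym2 V)) : ℝ :=
  sInf {c | ∃ f : ℕ → Assignment V ℓ, Serves k 1 src σ f ∧ cost k σ.length f = c}

/-- A deterministic online algorithm: its assignment after an edge insertion is a function of
the edges revealed so far, in their order of arrival. -/
abbrev OnlineAlgorithm (V : Type*) (ℓ : ℕ) := List (Sym2 V) → Assignment V ℓ

/-- The schedule produced by the online algorithm `A` on the request sequence `σ`. -/
def OnlineAlgorithm.run {V : Type*} {ℓ : ℕ} (A : OnlineAlgorithm V ℓ) (σ : List (Sym2 V)) :
    ℕ → Assignment V ℓ :=
  fun t => A (σ.take t)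

/-- `A` is strictly `ρ`-competitive with capacity `cap`: it serves every feasible request
sequence `σ` with capacity `cap`, at cost at most `ρ` times the offline optimum. -/
def IsCompetitive {V : Type*} [Fintype V] {ℓ : ℕ} (k : ℕ) (cap : ℝ) (src : Assignment V ℓ)
    (A : OnlineAlgorithm V ℓ) (ρ : ℝ) : Prop :=
  ∀ σ : List (Sym2 V), Feasible k src σ →
    Serves k cap src σ (A.run σ) ∧ cost k σ.length (A.run σ) ≤ ρ * optCost k src σ

end OnlineGraphPartitioning

/-! Call the initial server of a vertex its home. A piece `C` must leave at least `scatter src C`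
vertices away from home, so the final total scatter bounds the offline cost (times `k`) from below.
The truncated weight `min |C| (4 * scatter)` is superadditive, and `entropy` (weight times log size)
gains at least `w(C ∪ D) - w(C)` when `D` is merged into a piece `C` at least as large
(`entropy_union`). Total entropy is thus at most `4 * log₂ k` times total scatter.

The algorithm keeps each piece on one server, which must be the home of three quarters of its
vertices if such a server exists. A piece with `x` of its `n` vertices away stores credit `min n (4x
- n)`: none up to a quarter away, all of `n` from a half on. By `exists_server_for_union`, the moves
of a merge plus the change of credit cost at most `4 * (w(C ∪ D) - w(C))`, hence at most four times
the entropy gain.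

Merging may overload servers. A server holding more than `2k` vertices has a piece with less than
half of its vertices at home, as only `k` vertices have their home there. Such a piece has full
credit and no three-quarters server, so it may go to a server of load at most `k` without raising
its credit. Relief starts only above `(2 + δ)k` and continues down to `2k`, so its cost is at most
`1 + 2/δ` times the overload removed. `potential` combines overload, credit and entropy so that no
step has positive amortized cost. -/

namespace OnlineGraphPartitioning

/-! ### Scatter, weight, credit and entropy of pieces -/

section Pieces

variable {V : Type*} {ℓ : ℕ}

/-- The vertices of `C` whose initial server is not `s`, counted. -/
def away (src : Assignment V ℓ) (C : Finset V) (s : Fin ℓ) : ℕ :=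
  (C.filter fun v => src v ≠ s).card

/-- The least number of vertices of `C` that have to leave their initial server for all of `C`
to be on one server. -/
noncomputable def scatter (src : Assignment V ℓ) (C : Finset V) : ℕ :=
  sInf (Set.range (away src C))

/-- The scatter of `C`, scaled and truncated at the size of `C`. -/
noncomputable def weight (src : Assignment V ℓ) (C : Finset V) : ℕ :=
  min C.card (4 * scatter src C)

/-- The credit stored on a piece of size `n` with `x` vertices off their initial server. -/
def creditOf (n x : ℕ) : ℕ := min n (4 * x - n)

/-- The credit stored on `C` under the assignment `a`. -/
def credit (src a : Assignment V ℓ) (C : Finset V) : ℕ :=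
  creditOf C.card (C.filter fun v => src v ≠ a v).card

/-- The weight of `C`, multiplied by the logarithm of its size. -/
noncomputable def entropy (src : Assignment V ℓ) (C : Finset V) : ℝ :=
  weight src C * Real.logb 2 C.card

theorem scatter_le (src : Assignment V ℓ) (C : Finset V) (s : Fin ℓ) :
    scatter src C ≤ away src C s := Nat.sInf_le ⟨s, rfl⟩

theorem exists_scatter_eq (src : Assignment V ℓ) (C : Finset V) (s₀ : Fin ℓ) :
    ∃ s, away src C s = scatter src C :=
  Nat.sInf_mem (s := Set.range (away src C)) ⟨_, s₀, rfl⟩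

theorem away_union [DecidableEq V] (src : Assignment V ℓ) {C D : Finset V} (h : Disjoint C D)
    (s : Fin ℓ) : away src (C ∪ D) s = away src C s + away src D s := by
  unfold away
  rw [Finset.filter_union, Finset.card_union_of_disjoint]
  exact Finset.disjoint_filter_filter h

theorem away_le_card (src : Assignment V ℓ) (C : Finset V) (s : Fin ℓ) :
    away src C s ≤ C.card := Finset.card_filter_le _ _

/-- A vertex has only one home, so it is away from `s` or from `t`. Hence two servers cannot both be
home to three quarters of a nonempty piece. -/
theorem card_le_away_add_away (src : Assignment V ℓ) (C : Finset V) {s t : Fin ℓ} (h : s ≠ t) :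
    C.card ≤ away src C s + away src C t := by
  classical
  unfold away
  refine le_trans (Finset.card_le_card (t := (C.filter fun v => src v ≠ s) ∪
    (C.filter fun v => src v ≠ t)) ?_) (Finset.card_union_le _ _)
  intro v hv
  simp only [Finset.mem_union, Finset.mem_filter]
  by_cases h1 : src v = s
  · exact Or.inr ⟨hv, fun h2 => h (h1.symm.trans h2)⟩
  · exact Or.inl ⟨hv, h1⟩

theorem scatter_superadditive [DecidableEq V] (src : Assignment V ℓ) {C D : Finset V}
    (h : Disjoint C D) (s₀ : Fin ℓ) :
    scatter src C + scatter src D ≤ scatter src (C ∪ D) := by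
  obtain ⟨s, hs⟩ := exists_scatter_eq src (C ∪ D) s₀
  rw [← hs, away_union src h]
  exact add_le_add (scatter_le _ _ _) (scatter_le _ _ _)

/-- A minimum of superadditive functions is superadditive. -/
theorem weight_superadditive [DecidableEq V] (src : Assignment V ℓ) {C D : Finset V}
    (h : Disjoint C D) (s₀ : Fin ℓ) :
    weight src C + weight src D ≤ weight src (C ∪ D) := by
  have := scatter_superadditive src h s₀
  have := Finset.card_union_of_disjoint h
  unfold weight
  omega

theorem credit_eq {src a : Assignment V ℓ} {C : Finset V} {t : Fin ℓ} (h : ∀ v ∈ C, a v = t) :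
    credit src a C = creditOf C.card (away src C t) := by
  unfold credit away
  congr 2
  exact Finset.filter_congr fun v hv => by rw [h v hv]

theorem credit_congr {src a b : Assignment V ℓ} {C : Finset V} (h : ∀ v ∈ C, a v = b v) :
    credit src a C = credit src b C := by
  unfold credit
  congr 2
  exact Finset.filter_congr fun v hv => by rw [h v hv]

/-- The weight of the smaller piece `D` gains a factor of at least `1 + log |D|` in place of `log
|D|`, since `|C ∪ D| ≥ 2|D|`. The surplus weight `w(C ∪ D) - w(C) - w(D)` is multiplied by `log |C ∪
D| ≥ 1`. -/
theorem entropy_union [DecidableEq V] (src : Assignment V ℓ) {C D : Finset V}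
    (h : Disjoint C D) (hD : D.Nonempty) (hDC : D.card ≤ C.card) (s₀ : Fin ℓ) :
    entropy src C + entropy src D + ((weight src (C ∪ D) : ℝ) - weight src C) ≤
      entropy src (C ∪ D) := by
  have hw : (weight src C : ℝ) + weight src D ≤ weight src (C ∪ D) := by
    exact_mod_cast weight_superadditive src h s₀
  have hd : (0 : ℝ) < D.card := by exact_mod_cast hD.card_pos
  have hdc : (D.card : ℝ) ≤ C.card := by exact_mod_cast hDC
  have hE : ((C ∪ D).card : ℝ) = C.card + D.card := by
    exact_mod_cast Finset.card_union_of_disjoint h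
  have h1 : Real.logb 2 C.card ≤ Real.logb 2 (C ∪ D).card :=
    Real.logb_le_logb_of_le (by norm_num) (by linarith) (by linarith)
  have h2 : 1 + Real.logb 2 D.card ≤ Real.logb 2 (C ∪ D).card := by
    have : 1 + Real.logb 2 D.card = Real.logb 2 (2 * D.card) := by
      rw [Real.logb_mul (by norm_num) hd.ne', Real.logb_self_eq_one (by norm_num)]
    rw [this]
    exact Real.logb_le_logb_of_le (by norm_num) (by linarith) (by linarith)
  have h3 : 0 ≤ Real.logb 2 D.card :=
    Real.logb_nonneg (by norm_num) (by exact_mod_cast hD.card_pos)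
  unfold entropy
  have hc0 : (0 : ℝ) ≤ weight src C := Nat.cast_nonneg _
  have hd0 : (0 : ℝ) ≤ weight src D := Nat.cast_nonneg _
  nlinarith [mul_nonneg hc0 (sub_nonneg.2 h1), mul_nonneg hd0 (sub_nonneg.2 h2),
    mul_nonneg (sub_nonneg.2 hw) (show 0 ≤ Real.logb 2 (C ∪ D).card - 1 by linarith)]

/-- The server for a merged piece, with its amortized moving cost. -/
theorem exists_server_for_union [DecidableEq V] (src : Assignment V ℓ) {C D : Finset V}
    (h : Disjoint C D) (hD : D.Nonempty) (hDC : D.card ≤ C.card) (t t' : Fin ℓ)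
    (hheavyD : ∀ s, 4 * away src D s ≤ D.card → t' = s) :
    ∃ s, (∀ s', 4 * away src (C ∪ D) s' ≤ (C ∪ D).card → s = s') ∧
      (if t = s then 0 else C.card) + (if t' = s then 0 else D.card) +
        creditOf (C ∪ D).card (away src (C ∪ D) s) + 4 * weight src C ≤
      creditOf C.card (away src C t) + creditOf D.card (away src D t') +
        4 * weight src (C ∪ D) := by
  have hE := Finset.card_union_of_disjoint h
  have hd := hD.card_pos
  by_cases hex : ∃ s, 4 * away src (C ∪ D) s ≤ (C ∪ D).card
  · obtain ⟨s, hs⟩ := hex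
    have hother : ∀ s', s ≠ s' → (C ∪ D).card ≤ away src (C ∪ D) s + away src (C ∪ D) s' :=
      fun s' hs' => card_le_away_add_away src _ hs'
    refine ⟨s, fun s' hs' => ?_, ?_⟩
    · by_contra hne
      have := hother s' hne
      omega
    have hsc : scatter src (C ∪ D) = away src (C ∪ D) s := by
      refine le_antisymm (scatter_le _ _ _) ?_
      obtain ⟨s', hs'⟩ := exists_scatter_eq src (C ∪ D) s
      by_cases hne : s = s'
      · rw [← hs', ← hne]
      · have := hother s' hne
        omega
    -- Now the new credit is zero and `w(C ∪ D) = 4 * away src (C ∪ D) s`. If `C` moves, either its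
    -- credit is all of `|C|` or more than half of it is away from `s`. If `D` moves, more than a
    -- quarter of it is away from `s`. Either way the moves are paid for.
    have hu := away_union src h s
    have hC := scatter_le src C s
    have hCt : t ≠ s → C.card ≤ away src C t + away src C s := card_le_away_add_away src C
    have hDs : t' ≠ s → D.card < 4 * away src D s := fun hne => by
      by_contra hlt
      exact hne (hheavyD s (not_lt.1 hlt))
    unfold weight creditOf
    split_ifs with h1 h2 h2
    · omega
    · have := hDs h2
      omega
    · have := hCt h1
      omega
    · have := hDs h2
      have := hCt h1
      omega
  · push Not at hex
    -- With no three-quarters server, `w(C ∪ D) = |C ∪ D|`, which exceeds `w(C)` by at least `|D|`.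
    -- Staying at `t` costs at most `|D|` for moving `D` and `3|D|` in additional credit; this is
    -- where the factor 4 comes from.
    refine ⟨t, fun s' hs' => absurd hs' (not_le.2 (hex s')), ?_⟩
    obtain ⟨s', hs'⟩ := exists_scatter_eq src (C ∪ D) t
    have h1 := hex s'
    have h2 := away_union src h t
    have h3 := away_le_card src D t
    unfold weight creditOf
    rw [if_pos rfl]
    split_ifs <;> omega

end Pieces

/-! ### Loads, overload and rebalancing of a partition into pieces -/

section Partitions

variable {V : Type*} [Fintype V] {ℓ k : ℕ} {src a b c : Assignment V ℓ} {P : Finset (Finset V)}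

/-- The number of vertices on server `s`. -/
def load (a : Assignment V ℓ) (s : Fin ℓ) : ℕ := (Finset.univ.filter fun v => a v = s).card

/-- The number of vertices on which `a` and `b` differ. -/
def moved (a b : Assignment V ℓ) : ℕ := (Finset.univ.filter fun v => b v ≠ a v).card

/-- The total load above `2 * k`. -/
noncomputable def overload (k : ℕ) (a : Assignment V ℓ) : ℝ :=
  ∑ s, max 0 ((load a s : ℝ) - 2 * k)

/-- `P` is a partition of the vertices into nonempty pieces. -/
structure IsPartition (P : Finset (Finset V)) : Prop where
  cover : ∀ v, ∃ C ∈ P, v ∈ C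
  disj : ∀ C ∈ P, ∀ D ∈ P, C ≠ D → Disjoint C D
  nonempty : ∀ C ∈ P, C.Nonempty

/-- Every piece is on one server, namely the initial server of three quarters of its vertices
if there is one. -/
structure Consistent (src : Assignment V ℓ) (P : Finset (Finset V)) (a : Assignment V ℓ) :
    Prop where
  const : ∀ C ∈ P, ∃ s, ∀ v ∈ C, a v = s
  heavy : ∀ C ∈ P, ∀ s, 4 * away src C s ≤ C.card → ∀ v ∈ C, a v = s

theorem IsPartition.card_filter_eq_sum [DecidableEq V] (hP : IsPartition P) (q : V → Prop)
    [DecidablePred q] :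
    (Finset.univ.filter q).card = ∑ C ∈ P, (C.filter q).card := by
  rw [← Finset.card_biUnion]
  · congr 1
    ext v
    simp only [Finset.mem_filter, Finset.mem_univ, true_and, Finset.mem_biUnion]
    constructor
    · intro hv
      obtain ⟨C, hC, hvC⟩ := hP.cover v
      exact ⟨C, hC, hvC, hv⟩
    · rintro ⟨C, -, -, hv⟩
      exact hv
  · intro C hC D hD hne
    exact Finset.disjoint_filter_filter (hP.disj C hC D hD hne)

theorem sum_load (a : Assignment V ℓ) : ∑ s, load a s = Fintype.card V := by
  unfold load
  rw [← Finset.card_univ]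
  exact (Finset.card_eq_sum_card_fiberwise fun v _ => Finset.mem_univ (a v)).symm

theorem exists_load_le (hsrc : IsSourceAssignment k src) (s₀ : Fin ℓ) (a : Assignment V ℓ) :
    ∃ s, load a s ≤ k := by
  by_contra! h
  have h1 : ∑ s, load a s = ∑ s, load src s := by rw [sum_load, sum_load]
  have h2 : ∑ s, load src s = ∑ _s : Fin ℓ, k := Finset.sum_congr rfl fun s _ => hsrc s
  have h3 : ∑ _s : Fin ℓ, k < ∑ s, load a s :=
    Finset.sum_lt_sum_of_nonempty ⟨s₀, Finset.mem_univ _⟩ fun s _ => h s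
  omega

theorem moved_self (a : Assignment V ℓ) : moved a a = 0 := by simp [moved]

theorem moved_triangle (a b c : Assignment V ℓ) : moved a c ≤ moved a b + moved b c := by
  classical
  unfold moved
  refine le_trans (Finset.card_le_card ?_) (Finset.card_union_le _ _)
  intro v
  simp only [Finset.mem_filter, Finset.mem_univ, true_and, Finset.mem_union]
  intro h
  by_contra! h'
  exact h (h'.2.trans h'.1)

/-- The load of a server grows by at most the number of moved vertices that arrive there, and each
moved vertex arrives at one server. -/
theorem overload_le_add_moved (k : ℕ) (a b : Assignment V ℓ) :
    overload k b ≤ overload k a + moved a b := by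
  classical
  have h : ∀ s, load b s ≤ load a s +
      ((Finset.univ.filter fun v => b v ≠ a v).filter fun v => b v = s).card := by
    intro s
    unfold load
    refine le_trans (Finset.card_le_card ?_) (Finset.card_union_le _ _)
    intro v
    simp only [Finset.mem_filter, Finset.mem_univ, true_and, Finset.mem_union]
    intro hb
    by_cases hab : b v = a v
    · exact Or.inl (hab ▸ hb)
    · exact Or.inr ⟨hab, hb⟩
  have hm : (moved a b : ℝ) = ∑ s : Fin ℓ,
      (((Finset.univ.filter fun v => b v ≠ a v).filter fun v => b v = s).card : ℝ) := by
    unfold moved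
    rw [Finset.card_eq_sum_card_fiberwise (f := b) (t := Finset.univ)
      fun v _ => Finset.mem_univ _]
    push_cast
    rfl
  rw [hm]
  unfold overload
  rw [← Finset.sum_add_distrib]
  refine Finset.sum_le_sum fun s _ => ?_
  have hs : (load b s : ℝ) ≤ load a s +
    (((Finset.univ.filter fun v => b v ≠ a v).filter fun v => b v = s).card : ℝ) := by
    exact_mod_cast h s
  have h0 : (0 : ℝ) ≤
    (((Finset.univ.filter fun v => b v ≠ a v).filter fun v => b v = s).card : ℝ) :=
    Nat.cast_nonneg _
  refine max_le (add_nonneg (le_max_left _ _) h0) ?_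
  linarith [le_max_right (0 : ℝ) ((load a s : ℝ) - 2 * k)]

/-- A server on which every piece has at least half of its vertices at home is not overloaded. -/
theorem load_le_of_forall_away_le (hsrc : IsSourceAssignment k src) (hP : IsPartition P)
    (ha : Consistent src P a) (t : Fin ℓ)
    (h : ∀ C ∈ P, (∀ v ∈ C, a v = t) → 2 * away src C t ≤ C.card) : load a t ≤ 2 * k := by
  classical
  rw [← hsrc t]
  unfold load
  rw [hP.card_filter_eq_sum, hP.card_filter_eq_sum, Finset.mul_sum]
  refine Finset.sum_le_sum fun C hC => ?_
  obtain ⟨s, hs⟩ := ha.const C hC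
  -- A piece on `t` has at most twice as many vertices as it has vertices with home `t`, and these
  -- number `k` in total.
  by_cases hst : s = t
  · subst hst
    have h1 := h C hC hs
    have h2 : (C.filter fun v => src v = s).card + away src C s = C.card :=
      Finset.card_filter_add_card_filter_not _
    have h3 := Finset.card_filter_le C fun v => a v = s
    omega
  · rw [Finset.filter_false_of_mem]
    · simp
    · intro v hv hat
      exact hst ((hs v hv).symm.trans hat)

open scoped Classical in
/-- The assignment `a` with the piece `C` put on server `s`. -/
noncomputable def place (a : Assignment V ℓ) (C : Finset V) (s : Fin ℓ) : Assignment V ℓ :=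
  fun v => if v ∈ C then s else a v

omit [Fintype V] in
theorem place_of_mem {C : Finset V} {v : V} (h : v ∈ C) (s : Fin ℓ) : place a C s v = s :=
  if_pos h

omit [Fintype V] in
theorem place_of_notMem {C : Finset V} {v : V} (h : v ∉ C) (s : Fin ℓ) : place a C s v = a v :=
  if_neg h

theorem moved_place_le (a : Assignment V ℓ) (C : Finset V) (s : Fin ℓ) :
    moved a (place a C s) ≤ C.card := by
  refine Finset.card_le_card fun v hv => ?_
  by_contra h
  exact (Finset.mem_filter.1 hv).2 (place_of_notMem h s)

theorem load_place_le (a : Assignment V ℓ) (C : Finset V) (s : Fin ℓ) :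
    load (place a C s) s ≤ load a s + C.card := by
  classical
  refine le_trans (Finset.card_le_card ?_) (Finset.card_union_le _ _)
  intro v hv
  by_cases h : v ∈ C
  · exact Finset.mem_union_right _ h
  · refine Finset.mem_union_left _ ?_
    rw [Finset.mem_filter, place_of_notMem h] at hv
    exact Finset.mem_filter.2 hv

theorem load_place_of_ne (a : Assignment V ℓ) (C : Finset V) {s t : Fin ℓ} (h : t ≠ s) :
    load (place a C s) t ≤ load a t := by
  refine Finset.card_le_card fun v hv => ?_
  by_cases hC : v ∈ C
  · rw [Finset.mem_filter, place_of_mem hC] at hv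
    exact absurd hv.2.symm h
  · rw [Finset.mem_filter, place_of_notMem hC] at hv
    exact Finset.mem_filter.2 hv

theorem load_place_add_card {C : Finset V} {s t : Fin ℓ} (h : t ≠ s) (hC : ∀ v ∈ C, a v = t) :
    load (place a C s) t + C.card ≤ load a t := by
  classical
  unfold load
  rw [← Finset.card_union_of_disjoint]
  · refine Finset.card_le_card fun v hv => ?_
    by_cases hvC : v ∈ C
    · exact Finset.mem_filter.2 ⟨Finset.mem_univ _, hC v hvC⟩
    · rcases Finset.mem_union.1 hv with hv | hv
      · rw [Finset.mem_filter, place_of_notMem hvC] at hv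
        exact Finset.mem_filter.2 hv
      · exact absurd hv hvC
  · refine Finset.disjoint_left.2 fun v hv hvC => ?_
    rw [Finset.mem_filter, place_of_mem hvC] at hv
    exact h hv.2.symm

-- With more than half of `C` away from `t`, its credit is already the maximum `|C|`, so no new
-- server can raise it. No server can be home to three quarters of `C`, since consistency would
-- force that server to be `t`.
omit [Fintype V] in
theorem Consistent.place (hP : IsPartition P) (ha : Consistent src P a) {C : Finset V}
    (hC : C ∈ P) {t : Fin ℓ} (hCt : ∀ v ∈ C, a v = t) (haway : C.card < 2 * away src C t)
    (s : Fin ℓ) : Consistent src P (place a C s) ∧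
      ∑ D ∈ P, credit src (OnlineGraphPartitioning.place a C s) D ≤ ∑ D ∈ P, credit src a D := by
  have hne : ∀ D ∈ P, D ≠ C → ∀ v ∈ D, v ∉ C := fun D hD hDC v hv =>
    Finset.disjoint_left.1 (hP.disj D hD C hC hDC) hv
  refine ⟨⟨fun D hD => ?_, fun D hD s' hs' v hv => ?_⟩, Finset.sum_le_sum fun D hD => ?_⟩
  · by_cases hDC : D = C
    · subst hDC
      exact ⟨s, fun v hv => place_of_mem hv s⟩
    · obtain ⟨s', hs'⟩ := ha.const D hD
      exact ⟨s', fun v hv => (place_of_notMem (hne D hD hDC v hv) s).trans (hs' v hv)⟩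
  · by_cases hDC : D = C
    · subst hDC
      have hts : t = s' := (hCt v hv).symm.trans (ha.heavy D hD s' hs' v hv)
      subst hts
      omega
    · rw [place_of_notMem (hne D hD hDC v hv)]
      exact ha.heavy D hD s' hs' v hv
  · by_cases hDC : D = C
    · subst hDC
      rw [credit_eq hCt, credit_eq fun v hv => place_of_mem hv s]
      unfold creditOf
      omega
    · exact (credit_congr fun v hv => place_of_notMem (hne D hD hDC v hv) s).le

/-- Pieces can be moved away from server `t` until its load is at most `2 * k`. -/
theorem exists_relieve_server (hsrc : IsSourceAssignment k src) (hP : IsPartition P)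
    (hcard : ∀ C ∈ P, C.card ≤ k) (t : Fin ℓ) (ha : Consistent src P a) :
    ∃ b, Consistent src P b ∧ ∑ C ∈ P, credit src b C ≤ ∑ C ∈ P, credit src a C ∧
      load b t ≤ 2 * k ∧ (∀ s, s ≠ t → load b s ≤ max (load a s) (2 * k)) ∧
      moved a b + load b t ≤ load a t := by
  induction hn : load a t using Nat.strong_induction_on generalizing a with
  | _ n ih =>
  subst hn
  by_cases hle : load a t ≤ 2 * k
  · exact ⟨a, ha, le_rfl, hle, fun s _ => le_max_left _ _, by rw [moved_self, zero_add]⟩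
  have hex : ∃ C ∈ P, (∀ v ∈ C, a v = t) ∧ C.card < 2 * away src C t := by
    by_contra! h
    exact hle (load_le_of_forall_away_le hsrc hP ha t h)
  obtain ⟨C, hC, hCt, haway⟩ := hex
  obtain ⟨s, hs⟩ := exists_load_le hsrc t a
  have hts : t ≠ s := by
    rintro rfl
    omega
  obtain ⟨hc, hcredit⟩ := ha.place hP hC hCt haway s
  have hload := load_place_add_card hts hCt
  have hpos := (hP.nonempty C hC).card_pos
  obtain ⟨b, hb, hbc, hbt, hbs, hbm⟩ := ih _ (by omega) hc rfl
  refine ⟨b, hb, hbc.trans hcredit, hbt, fun s' hs' => ?_, ?_⟩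
  · refine (hbs s' hs').trans (max_le ?_ (le_max_right _ _))
    by_cases hss : s' = s
    · subst hss
      -- The receiving server had load at most `k` and `C` has at most `k` vertices, so no new
      -- overload arises.
      have h1 := load_place_le a C s'
      have h2 := hcard C hC
      exact le_max_of_le_right (by omega)
    · exact le_max_of_le_left (load_place_of_ne a C hss)
  · have h1 := moved_triangle a (OnlineGraphPartitioning.place a C s) b
    have h2 := moved_place_le a C s
    omega

/-- Pieces can be moved such that no server has more than `(2 + δ) * k` vertices, at a cost
bounded by the decrease of the overload. -/
theorem exists_relieve (hsrc : IsSourceAssignment k src) (hP : IsPartition P)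
    (hcard : ∀ C ∈ P, C.card ≤ k) {δ : ℝ} (hδ : 0 < δ) (ha : Consistent src P a) :
    ∃ b, Consistent src P b ∧ ∑ C ∈ P, credit src b C ≤ ∑ C ∈ P, credit src a C ∧
      (∀ s, (load b s : ℝ) ≤ (2 + δ) * k) ∧
      (moved a b : ℝ) + (1 + 2 / δ) * overload k b ≤ (1 + 2 / δ) * overload k a := by
  -- Servers are relieved one at a time. Those already treated stay within bounds, because a
  -- receiver is never pushed above `2 * k`.
  suffices H : ∀ S : Finset (Fin ℓ), ∃ b, Consistent src P b ∧
      ∑ C ∈ P, credit src b C ≤ ∑ C ∈ P, credit src a C ∧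
      (∀ s ∈ S, (load b s : ℝ) ≤ (2 + δ) * k) ∧
      (moved a b : ℝ) + (1 + 2 / δ) * overload k b ≤ (1 + 2 / δ) * overload k a by
    obtain ⟨b, h1, h2, h3, h4⟩ := H Finset.univ
    exact ⟨b, h1, h2, fun s => h3 s (Finset.mem_univ s), h4⟩
  intro S
  induction S using Finset.induction_on with
  | empty => exact ⟨a, ha, le_rfl, by simp, by simp [moved_self]⟩
  | insert t S _ ih =>
    obtain ⟨b, hb, hbc, hbS, hbm⟩ := ih
    by_cases hle : (load b t : ℝ) ≤ (2 + δ) * k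
    · refine ⟨b, hb, hbc, fun s hs => ?_, hbm⟩
      rcases Finset.mem_insert.1 hs with rfl | hs
      · exact hle
      · exact hbS s hs
    push Not at hle
    have hk : (0 : ℝ) ≤ k := Nat.cast_nonneg k
    have hkδ : 0 ≤ δ * k := mul_nonneg hδ.le hk
    obtain ⟨c, hc, hcc, hct, hcs, hcm⟩ := exists_relieve_server hsrc hP hcard t hb
    have hct' : (load c t : ℝ) ≤ 2 * k := by exact_mod_cast hct
    have hcs' : ∀ s, s ≠ t → (load c s : ℝ) ≤ max (load b s : ℝ) (2 * k) := fun s hs => by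
      exact_mod_cast hcs s hs
    refine ⟨c, hc, hcc.trans hbc, fun s hs => ?_, ?_⟩
    · by_cases hst : s = t
      · subst hst
        linarith
      · refine (hcs' s hst).trans (max_le (hbS s ?_) (by linarith))
        exact (Finset.mem_insert.1 hs).resolve_left hst
    · have hover : overload k c + ((load b t : ℝ) - 2 * k) ≤ overload k b := by
        unfold overload
        rw [← Finset.add_sum_erase _ _ (Finset.mem_univ t),
          ← Finset.add_sum_erase (a := t) Finset.univ _ (Finset.mem_univ t)]
        have h1 : max 0 ((load c t : ℝ) - 2 * k) = 0 := max_eq_left (by linarith)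
        have h2 : (load b t : ℝ) - 2 * k ≤ max 0 ((load b t : ℝ) - 2 * k) := le_max_right _ _
        have h3 : ∑ s ∈ Finset.univ.erase t, max 0 ((load c s : ℝ) - 2 * k) ≤
            ∑ s ∈ Finset.univ.erase t, max 0 ((load b s : ℝ) - 2 * k) := by
          refine Finset.sum_le_sum fun s hs => max_le (le_max_left _ _) ?_
          rcases le_max_iff.1 (hcs' s (Finset.ne_of_mem_erase hs)) with h | h
          · exact le_max_of_le_right (by linarith)
          · exact le_max_of_le_left (by linarith)
        linarith
      have hmul := mul_le_mul_of_nonneg_left hover (show 0 ≤ 1 + 2 / δ by positivity)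
      -- The excess over `2k` is more than `δk`, so `2k` is at most `2/δ` times the excess.
      have hbound : (load b t : ℝ) ≤ (1 + 2 / δ) * ((load b t : ℝ) - 2 * k) := by
        have : δ * k * (2 / δ) = 2 * k := by field_simp
        have h2 : δ * k * (2 / δ) ≤ ((load b t : ℝ) - 2 * k) * (2 / δ) :=
          mul_le_mul_of_nonneg_right (by linarith) (by positivity)
        linarith
      have htri : (moved a c : ℝ) ≤ moved a b + moved b c := by
        exact_mod_cast moved_triangle a b c
      have hcm' : (moved b c : ℝ) + load c t ≤ load b t := by exact_mod_cast hcm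
      have h0 : (0 : ℝ) ≤ load c t := Nat.cast_nonneg _
      linarith

/-- The potential function of the amortized analysis. -/
noncomputable def potential (k : ℕ) (μ : ℝ) (src : Assignment V ℓ) (P : Finset (Finset V))
    (a : Assignment V ℓ) : ℝ :=
  μ * overload k a +
    (1 + μ) * ((∑ C ∈ P, credit src a C : ℕ) - 4 * ∑ C ∈ P, entropy src C)

/-- Merging two pieces: there is a consistent assignment at nonpositive amortized cost. -/
theorem exists_merge [DecidableEq V] (hP : IsPartition P) (ha : Consistent src P a)
    {C D : Finset V} (hC : C ∈ P) (hD : D ∈ P) (hCD : C ≠ D) (hDC : D.card ≤ C.card)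
    {μ : ℝ} (hμ : 0 ≤ μ) :
    ∃ b, Consistent src (insert (C ∪ D) ((P.erase C).erase D)) b ∧
      moved a b + potential k μ src (insert (C ∪ D) ((P.erase C).erase D)) b ≤
        potential k μ src P a := by
  have hdis := hP.disj C hC D hD hCD
  obtain ⟨t, ht⟩ := ha.const C hC
  obtain ⟨t', ht'⟩ := ha.const D hD
  obtain ⟨v₀, hv₀⟩ := hP.nonempty D hD
  obtain ⟨s, hheavy, hcost⟩ := exists_server_for_union src hdis ⟨v₀, hv₀⟩ hDC t t'
    (fun s hs => (ht' v₀ hv₀).symm.trans (ha.heavy D hD s hs v₀ hv₀))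
  set R := (P.erase C).erase D with hR
  have hRP : ∀ {X}, X ∈ R → X ∈ P := fun hX =>
    Finset.mem_of_mem_erase (Finset.mem_of_mem_erase hX)
  have hRE : ∀ X ∈ R, ∀ v ∈ X, v ∉ C ∪ D := by
    intro X hX v hv hvE
    rcases Finset.mem_union.1 hvE with h | h
    · exact Finset.disjoint_left.1 (hP.disj X (hRP hX) C hC
        (Finset.ne_of_mem_erase (Finset.mem_of_mem_erase hX))) hv h
    · exact Finset.disjoint_left.1 (hP.disj X (hRP hX) D hD (Finset.ne_of_mem_erase hX)) hv h
  have hER : C ∪ D ∉ R := fun h => hRE _ h v₀ (Finset.mem_union_right _ hv₀)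
    (Finset.mem_union_right _ hv₀)
  have hsum : ∀ {M : Type} [AddCommMonoid M] (f : Finset V → M),
      ∑ X ∈ P, f X = f C + (f D + ∑ X ∈ R, f X) := fun f => by
    rw [← Finset.add_sum_erase _ f hC,
      ← Finset.add_sum_erase _ f (Finset.mem_erase.2 ⟨hCD.symm, hD⟩)]
  refine ⟨place a (C ∪ D) s, ⟨fun X hX => ?_, fun X hX s' hs' v hv => ?_⟩, ?_⟩
  · rcases Finset.mem_insert.1 hX with rfl | hX
    · exact ⟨s, fun v hv => place_of_mem hv s⟩
    · obtain ⟨s', hs'⟩ := ha.const X (hRP hX)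
      exact ⟨s', fun v hv => (place_of_notMem (hRE X hX v hv) s).trans (hs' v hv)⟩
  · rcases Finset.mem_insert.1 hX with rfl | hX
    · exact (place_of_mem hv s).trans (hheavy s' hs')
    · exact (place_of_notMem (hRE X hX v hv) s).trans (ha.heavy X (hRP hX) s' hs' v hv)
  · have hmoved : moved a (place a (C ∪ D) s) ≤
        (if t = s then 0 else C.card) + (if t' = s then 0 else D.card) := by
      have key : ∀ {X : Finset V} {r : Fin ℓ}, (∀ v ∈ X, a v = r) →
          (X.filter fun v => s ≠ a v).card ≤ if r = s then 0 else X.card := by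
        intro X r hX
        split_ifs with h
        · rw [Finset.filter_false_of_mem]
          · simp
          · intro v hv hne
            exact hne (h.symm.trans (hX v hv).symm)
        · exact Finset.card_filter_le _ _
      refine le_trans ?_ (add_le_add (key ht) (key ht'))
      refine le_trans (Finset.card_le_card ?_) (Finset.card_union_le _ _)
      intro v hv
      rw [Finset.mem_filter] at hv
      by_cases hvE : v ∈ C ∪ D
      · rw [place_of_mem hvE] at hv
        rw [← Finset.filter_union]
        exact Finset.mem_filter.2 ⟨hvE, hv.2⟩
      · exact absurd (place_of_notMem hvE s) hv.2
    have hover := overload_le_add_moved k a (place a (C ∪ D) s)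
    have hent := entropy_union src hdis ⟨v₀, hv₀⟩ hDC s
    have hcr : ∑ X ∈ R, credit src (place a (C ∪ D) s) X = ∑ X ∈ R, credit src a X :=
      Finset.sum_congr rfl fun X hX =>
        credit_congr fun v hv => place_of_notMem (hRE X hX v hv) s
    unfold potential
    rw [Finset.sum_insert hER, Finset.sum_insert hER, hsum, hsum, hcr,
      credit_eq fun v hv => place_of_mem hv s, credit_eq ht, credit_eq ht']
    have hcost' : (moved a (place a (C ∪ D) s) : ℝ) +
        creditOf (C ∪ D).card (away src (C ∪ D) s) + 4 * weight src C ≤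
        creditOf C.card (away src C t) + creditOf D.card (away src D t') +
        4 * weight src (C ∪ D) := by
      exact_mod_cast le_trans (by gcongr) hcost
    push_cast
    -- Each moved vertex costs 1 and adds at most `μ` through the overload, which explains the
    -- factor `1 + μ` in the potential.
    nlinarith [mul_le_mul_of_nonneg_left hover hμ,
      mul_le_mul_of_nonneg_left hcost' (show 0 ≤ 1 + μ by linarith),
      mul_le_mul_of_nonneg_left hent (show 0 ≤ 1 + μ by linarith)]

end Partitions

/-! ### Connected components and the effect of a new edge -/

section Algorithm

variable {V : Type*} [Fintype V] {ℓ k : ℕ} {src a : Assignment V ℓ} {σ : List (Sym2 V)}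

open scoped Classical in
/-- The vertex set of the connected component of `v`. -/
noncomputable def piece (G : SimpleGraph V) (v : V) : Finset V :=
  Finset.univ.filter fun u => G.Reachable v u

open scoped Classical in
/-- The vertex sets of the connected components. -/
noncomputable def pieces (G : SimpleGraph V) : Finset (Finset V) :=
  Finset.univ.image (piece G)

theorem mem_piece {G : SimpleGraph V} {u v : V} : u ∈ piece G v ↔ G.Reachable v u := by
  simp [piece]

theorem mem_pieces {G : SimpleGraph V} {C : Finset V} : C ∈ pieces G ↔ ∃ v, piece G v = C := by
  simp [pieces]

theorem piece_mem_pieces (G : SimpleGraph V) (v : V) : piece G v ∈ pieces G :=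
  mem_pieces.2 ⟨v, rfl⟩

theorem piece_eq_piece_iff {G : SimpleGraph V} {u v : V} :
    piece G u = piece G v ↔ G.Reachable u v := by
  refine ⟨fun h => mem_piece.1 (h ▸ mem_piece.2 (SimpleGraph.Reachable.refl v)), fun h => ?_⟩
  ext w
  rw [mem_piece, mem_piece]
  exact ⟨fun hw => h.symm.trans hw, fun hw => h.trans hw⟩

theorem isPartition_pieces (G : SimpleGraph V) : IsPartition (pieces G) where
  cover v := ⟨_, piece_mem_pieces G v, mem_piece.2 (SimpleGraph.Reachable.refl v)⟩
  disj := by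
    intro C hC D hD hne
    obtain ⟨u, rfl⟩ := mem_pieces.1 hC
    obtain ⟨v, rfl⟩ := mem_pieces.1 hD
    refine Finset.disjoint_left.2 fun w hu hv => hne ?_
    exact piece_eq_piece_iff.2 ((mem_piece.1 hu).trans (mem_piece.1 hv).symm)
  nonempty := by
    intro C hC
    obtain ⟨v, rfl⟩ := mem_pieces.1 hC
    exact ⟨v, mem_piece.2 (SimpleGraph.Reachable.refl v)⟩

omit [Fintype V] in
theorem revealedGraph_append_adj {u v x y : V} :
    (revealedGraph (σ ++ [s(u, v)])).Adj x y ↔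
      (revealedGraph σ).Adj x y ∨ s(x, y) = s(u, v) ∧ x ≠ y := by
  simp only [revealedGraph, SimpleGraph.fromEdgeSet_adj, Set.mem_ofPred_eq, List.mem_append,
    List.mem_singleton]
  tauto

omit [Fintype V] in
theorem revealedGraph_append_reachable {u v x y : V} :
    (revealedGraph (σ ++ [s(u, v)])).Reachable x y ↔
      (revealedGraph σ).Reachable x y ∨
      (revealedGraph σ).Reachable x u ∧ (revealedGraph σ).Reachable v y ∨
      (revealedGraph σ).Reachable x v ∧ (revealedGraph σ).Reachable u y := by
  constructor
  · rintro ⟨p⟩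
    induction p with
    | nil => exact Or.inl (SimpleGraph.Reachable.refl _)
    | @cons x w y h p ih =>
      rcases revealedGraph_append_adj.1 h with h | ⟨h, -⟩
      · rcases ih with ih | ih | ih
        · exact Or.inl (h.reachable.trans ih)
        · exact Or.inr (Or.inl ⟨h.reachable.trans ih.1, ih.2⟩)
        · exact Or.inr (Or.inr ⟨h.reachable.trans ih.1, ih.2⟩)
      · rcases Sym2.eq_iff.1 h with ⟨rfl, rfl⟩ | ⟨rfl, rfl⟩
        · rcases ih with ih | ih | ih
          · exact Or.inr (Or.inl ⟨SimpleGraph.Reachable.refl _, ih⟩)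
          · exact Or.inr (Or.inl ⟨SimpleGraph.Reachable.refl _, ih.2⟩)
          · exact Or.inl ih.2
        · rcases ih with ih | ih | ih
          · exact Or.inr (Or.inr ⟨SimpleGraph.Reachable.refl _, ih⟩)
          · exact Or.inl ih.2
          · exact Or.inr (Or.inr ⟨SimpleGraph.Reachable.refl _, ih.2⟩)
  · have hle : revealedGraph σ ≤ revealedGraph (σ ++ [s(u, v)]) := fun x y h =>
      revealedGraph_append_adj.2 (Or.inl h)
    have huv : (revealedGraph (σ ++ [s(u, v)])).Reachable u v := by
      by_cases h : u = v
      · exact h ▸ SimpleGraph.Reachable.refl u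
      · exact (revealedGraph_append_adj.2 (Or.inr ⟨rfl, h⟩)).reachable
    rintro (h | h | h)
    · exact h.mono hle
    · exact ((h.1.mono hle).trans huv).trans (h.2.mono hle)
    · exact ((h.1.mono hle).trans huv.symm).trans (h.2.mono hle)

theorem pieces_append_of_reachable {u v : V} (h : (revealedGraph σ).Reachable u v) :
    pieces (revealedGraph (σ ++ [s(u, v)])) = pieces (revealedGraph σ) := by
  have : piece (revealedGraph (σ ++ [s(u, v)])) = piece (revealedGraph σ) := by
    funext w
    ext x
    rw [mem_piece, mem_piece, revealedGraph_append_reachable]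
    refine ⟨?_, Or.inl⟩
    rintro (h' | h' | h')
    · exact h'
    · exact (h'.1.trans h).trans h'.2
    · exact (h'.1.trans h.symm).trans h'.2
  unfold pieces
  rw [this]

theorem pieces_append_of_not_reachable [DecidableEq V] {u v : V} :
    pieces (revealedGraph (σ ++ [s(u, v)])) =
      insert (piece (revealedGraph σ) u ∪ piece (revealedGraph σ) v)
        (((pieces (revealedGraph σ)).erase (piece (revealedGraph σ) u)).erase
          (piece (revealedGraph σ) v)) := by
  have h1 : ∀ w, (revealedGraph σ).Reachable u w ∨ (revealedGraph σ).Reachable v w →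
      piece (revealedGraph (σ ++ [s(u, v)])) w =
        piece (revealedGraph σ) u ∪ piece (revealedGraph σ) v := by
    intro w hw
    ext x
    rw [Finset.mem_union, mem_piece, mem_piece, mem_piece, revealedGraph_append_reachable]
    constructor
    · rintro (h | h | h)
      · exact hw.imp (fun h' => h'.trans h) fun h' => h'.trans h
      · exact Or.inr h.2
      · exact Or.inl h.2
    · rintro (h | h) <;> rcases hw with hw | hw
      · exact Or.inl (hw.symm.trans h)
      · exact Or.inr (Or.inr ⟨hw.symm, h⟩)
      · exact Or.inr (Or.inl ⟨hw.symm, h⟩)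
      · exact Or.inl (hw.symm.trans h)
  have h2 : ∀ w, ¬ (revealedGraph σ).Reachable u w → ¬ (revealedGraph σ).Reachable v w →
      piece (revealedGraph (σ ++ [s(u, v)])) w = piece (revealedGraph σ) w := by
    intro w hu hv
    ext x
    rw [mem_piece, mem_piece, revealedGraph_append_reachable]
    refine ⟨?_, Or.inl⟩
    rintro (h | h | h)
    · exact h
    · exact absurd h.1.symm hu
    · exact absurd h.1.symm hv
  ext X
  rw [Finset.mem_insert, Finset.mem_erase, Finset.mem_erase, mem_pieces, mem_pieces]
  constructor
  · rintro ⟨w, rfl⟩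
    by_cases hw : (revealedGraph σ).Reachable u w ∨ (revealedGraph σ).Reachable v w
    · exact Or.inl (h1 w hw)
    · push Not at hw
      rw [h2 w hw.1 hw.2]
      exact Or.inr ⟨fun h => hw.2 (piece_eq_piece_iff.1 h).symm,
        fun h => hw.1 (piece_eq_piece_iff.1 h).symm, w, rfl⟩
  · rintro (rfl | ⟨hv, hu, w, rfl⟩)
    · exact ⟨u, h1 u (Or.inl (SimpleGraph.Reachable.refl u))⟩
    · exact ⟨w, h2 w (fun h => hu (piece_eq_piece_iff.2 h.symm))
        fun h => hv (piece_eq_piece_iff.2 h.symm)⟩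

theorem Consistent.ccCondition (h : Consistent src (pieces (revealedGraph σ)) a) :
    CCCondition σ a := by
  intro u v huv
  obtain ⟨s, hs⟩ := h.const _ (piece_mem_pieces _ u)
  rw [hs u (mem_piece.2 (SimpleGraph.Reachable.refl u)), hs v (mem_piece.2 huv)]

omit [Fintype V] in
theorem revealedGraph_nil_reachable {u v : V} :
    (revealedGraph ([] : List (Sym2 V))).Reachable u v ↔ u = v := by
  have : revealedGraph ([] : List (Sym2 V)) = ⊥ := by
    ext x y
    simp [revealedGraph]
  rw [this, SimpleGraph.reachable_bot]

theorem piece_nil (v : V) : piece (revealedGraph ([] : List (Sym2 V))) v = {v} := by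
  ext u
  rw [mem_piece, revealedGraph_nil_reachable, Finset.mem_singleton, eq_comm]

/-! ### Bounds from offline schedules -/

theorem Feasible.prefix {e : Sym2 V} (h : Feasible k src (σ ++ [e])) : Feasible k src σ := by
  obtain ⟨f, hf⟩ := h
  have htake : ∀ t, t ≤ σ.length → (σ ++ [e]).take t = σ.take t := fun t ht =>
    List.take_append_of_le_length ht
  have hlen : (σ ++ [e]).length = σ.length + 1 := by simp
  refine ⟨f, hf.init, fun t h1 h2 => ?_, fun t h1 h2 => hf.capacity t h1 (by omega)⟩
  rw [← htake t h2]
  exact hf.cc t h1 (by omega)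

/-- In a feasible sequence every piece is constant under the final offline assignment. -/
theorem Serves.const_pieces {cap : ℝ} {f : ℕ → Assignment V ℓ} (hf : Serves k cap src σ f)
    (v : V) : ∀ u ∈ piece (revealedGraph σ) v, f σ.length u = f σ.length v := by
  intro u hu
  rcases σ.eq_nil_or_concat with rfl | h
  · rw [piece_nil, Finset.mem_singleton] at hu
    rw [hu]
  · have hpos : 1 ≤ σ.length := by
      obtain ⟨L, b, rfl⟩ := h
      simp
    have := hf.cc σ.length hpos le_rfl
    rw [List.take_length] at this
    exact (this v u (mem_piece.1 hu)).symm

/-- An offline schedule holds the whole piece on one server of capacity `k`. The empty sequence is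
separate because `Serves` imposes no capacity at time 0. -/
theorem Feasible.card_le (hk : 1 ≤ k) (h : Feasible k src σ) :
    ∀ C ∈ pieces (revealedGraph σ), C.card ≤ k := by
  intro C hC
  obtain ⟨v, rfl⟩ := mem_pieces.1 hC
  obtain ⟨f, hf⟩ := h
  rcases σ.eq_nil_or_concat with rfl | h
  · rw [piece_nil]
    simpa using hk
  · have hpos : 1 ≤ σ.length := by
      obtain ⟨L, b, rfl⟩ := h
      simp
    have hcap := hf.capacity σ.length hpos le_rfl (f σ.length v)
    have hk' : (0 : ℝ) < k := by exact_mod_cast hk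
    unfold volume at hcap
    rw [div_le_one hk'] at hcap
    refine le_trans (Finset.card_le_card fun u hu => ?_) (Nat.cast_le.1 hcap)
    exact Finset.mem_filter.2 ⟨Finset.mem_univ _, hf.const_pieces v u hu⟩

theorem moved_zero_le_sum (f : ℕ → Assignment V ℓ) (T : ℕ) :
    moved (f 0) (f T) ≤ ∑ t ∈ Finset.range T, moved (f t) (f (t + 1)) := by
  induction T with
  | zero => simp [moved_self]
  | succ T ih =>
    rw [Finset.sum_range_succ]
    exact (moved_triangle _ (f T) _).trans (Nat.add_le_add_right ih _)

theorem mul_cost (hk : 1 ≤ k) (T : ℕ) (f : ℕ → Assignment V ℓ) :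
    k * cost k T f = ∑ t ∈ Finset.range T, (moved (f t) (f (t + 1)) : ℝ) := by
  have hk' : (k : ℝ) ≠ 0 := by
    have : k ≠ 0 := by omega
    exact_mod_cast this
  unfold cost volume moved
  rw [← Finset.sum_div]
  field_simp

/-- At the end each piece lies on one server, so at least its scatter many vertices are away from
home, and each of them has been moved at least once. -/
theorem Serves.sum_scatter_le (hk : 1 ≤ k) {cap : ℝ} {f : ℕ → Assignment V ℓ}
    (hf : Serves k cap src σ f) :
    ((∑ C ∈ pieces (revealedGraph σ), scatter src C : ℕ) : ℝ) ≤ k * cost k σ.length f := by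
  classical
  rw [mul_cost hk]
  have h := moved_zero_le_sum f σ.length
  rw [hf.init] at h
  refine le_trans (Nat.cast_le.2 (le_trans ?_ h)) (by push_cast; rfl)
  unfold moved
  rw [(isPartition_pieces (revealedGraph σ)).card_filter_eq_sum]
  refine Finset.sum_le_sum fun C hC => ?_
  obtain ⟨v, rfl⟩ := mem_pieces.1 hC
  refine (scatter_le src _ (f σ.length v)).trans (Finset.card_le_card fun u hu => ?_)
  rw [Finset.mem_filter] at hu ⊢
  rw [hf.const_pieces v u hu.1]
  exact ⟨hu.1, hu.2.symm⟩

omit [Fintype V] in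
theorem sum_entropy_le (hk : 1 ≤ k) {P : Finset (Finset V)} (hP : IsPartition P)
    (hcard : ∀ C ∈ P, C.card ≤ k) :
    ∑ C ∈ P, entropy src C ≤ 4 * Real.logb 2 k * (∑ C ∈ P, scatter src C : ℕ) := by
  push_cast
  rw [Finset.mul_sum]
  refine Finset.sum_le_sum fun C hC => ?_
  have hpos := (hP.nonempty C hC).card_pos
  have h1 : Real.logb 2 C.card ≤ Real.logb 2 k :=
    Real.logb_le_logb_of_le (by norm_num) (by exact_mod_cast hpos)
      (by exact_mod_cast hcard C hC)
  have h2 : (weight src C : ℝ) ≤ 4 * scatter src C := by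
    exact_mod_cast min_le_right _ _
  have h3 : 0 ≤ Real.logb 2 k := Real.logb_nonneg (by norm_num) (by exact_mod_cast hk)
  unfold entropy
  calc _ ≤ (weight src C : ℝ) * Real.logb 2 k := by gcongr
    _ ≤ 4 * scatter src C * Real.logb 2 k := by gcongr
    _ = _ := by ring

/-! ### The online algorithm and its competitive ratio -/

/-- Reacting to one more edge: there is an admissible assignment at nonpositive amortized
cost. -/
theorem exists_step (hk : 1 ≤ k) (hsrc : IsSourceAssignment k src) {δ : ℝ} (hδ : 0 < δ)
    {e : Sym2 V} (h : Feasible k src (σ ++ [e]))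
    (ha : Consistent src (pieces (revealedGraph σ)) a) :
    ∃ b, Consistent src (pieces (revealedGraph (σ ++ [e]))) b ∧
      (∀ s, (load b s : ℝ) ≤ (2 + δ) * k) ∧
      moved a b + potential k (1 + 2 / δ) src (pieces (revealedGraph (σ ++ [e]))) b ≤
        potential k (1 + 2 / δ) src (pieces (revealedGraph σ)) a := by
  classical
  have hμ : 0 ≤ 1 + 2 / δ := by positivity
  have hmerge : ∃ b, Consistent src (pieces (revealedGraph (σ ++ [e]))) b ∧
      moved a b + potential k (1 + 2 / δ) src (pieces (revealedGraph (σ ++ [e]))) b ≤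
        potential k (1 + 2 / δ) src (pieces (revealedGraph σ)) a := by
    induction e using Sym2.ind with
    | _ u v =>
    by_cases huv : (revealedGraph σ).Reachable u v
    · rw [pieces_append_of_reachable huv]
      exact ⟨a, ha, by simp [moved_self]⟩
    · have hP := isPartition_pieces (revealedGraph σ)
      have hu := piece_mem_pieces (revealedGraph σ) u
      have hv := piece_mem_pieces (revealedGraph σ) v
      have hne : piece (revealedGraph σ) u ≠ piece (revealedGraph σ) v := fun h' =>
        huv (piece_eq_piece_iff.1 h')
      rw [pieces_append_of_not_reachable]
      rcases le_total (piece (revealedGraph σ) v).card (piece (revealedGraph σ) u).card with hc | hc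
      · exact exists_merge hP ha hu hv hne hc hμ
      · rw [Finset.union_comm, Finset.erase_right_comm]
        exact exists_merge hP ha hv hu hne.symm hc hμ
  obtain ⟨b, hb, hbm⟩ := hmerge
  -- Relief keeps the partition and hence the entropy. With `μ = 1 + 2 / δ` the fall of the overload
  -- term pays for its moves.
  obtain ⟨c, hc, hcc, hcl, hcm⟩ := exists_relieve hsrc (isPartition_pieces _) (h.card_le hk) hδ hb
  refine ⟨c, hc, hcl, ?_⟩
  have htri : (moved a c : ℝ) ≤ moved a b + moved b c := by exact_mod_cast moved_triangle a b c
  have hcc' : ((∑ C ∈ pieces (revealedGraph (σ ++ [e])), credit src c C : ℕ) : ℝ) ≤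
      (∑ C ∈ pieces (revealedGraph (σ ++ [e])), credit src b C : ℕ) := by exact_mod_cast hcc
  have hmul := mul_le_mul_of_nonneg_left hcc' (show 0 ≤ 1 + (1 + 2 / δ) by linarith)
  unfold potential at hbm ⊢
  linarith

open scoped Classical in
/-- The online algorithm: after each insertion it takes an admissible assignment at nonpositive
amortized cost. -/
noncomputable def amortizedAlgorithm (k : ℕ) (δ : ℝ) (src : Assignment V ℓ) :
    OnlineAlgorithm V ℓ := fun σ =>
  List.reverseRecOn σ src fun σ e a =>
    -- The default `a` is never used along a feasible sequence, by `exists_step`.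
    if h : ∃ b, Consistent src (pieces (revealedGraph (σ ++ [e]))) b ∧
      (∀ s, (load b s : ℝ) ≤ (2 + δ) * k) ∧
      moved a b + potential k (1 + 2 / δ) src (pieces (revealedGraph (σ ++ [e]))) b ≤
        potential k (1 + 2 / δ) src (pieces (revealedGraph σ)) a
    then h.choose else a

theorem amortizedAlgorithm_nil (k : ℕ) (δ : ℝ) (src : Assignment V ℓ) :
    amortizedAlgorithm k δ src [] = src := by
  unfold amortizedAlgorithm
  rw [List.reverseRecOn_nil]

theorem amortizedAlgorithm_append (hk : 1 ≤ k) (hsrc : IsSourceAssignment k src) {δ : ℝ}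
    (hδ : 0 < δ) {e : Sym2 V} (h : Feasible k src (σ ++ [e]))
    (ha : Consistent src (pieces (revealedGraph σ)) (amortizedAlgorithm k δ src σ)) :
    Consistent src (pieces (revealedGraph (σ ++ [e]))) (amortizedAlgorithm k δ src (σ ++ [e])) ∧
      (∀ s, (load (amortizedAlgorithm k δ src (σ ++ [e])) s : ℝ) ≤ (2 + δ) * k) ∧
      moved (amortizedAlgorithm k δ src σ) (amortizedAlgorithm k δ src (σ ++ [e])) +
          potential k (1 + 2 / δ) src (pieces (revealedGraph (σ ++ [e])))
            (amortizedAlgorithm k δ src (σ ++ [e])) ≤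
        potential k (1 + 2 / δ) src (pieces (revealedGraph σ))
          (amortizedAlgorithm k δ src σ) := by
  have hex := exists_step hk hsrc hδ h ha
  have heq : amortizedAlgorithm k δ src (σ ++ [e]) = hex.choose := by
    unfold amortizedAlgorithm at hex ⊢
    rw [List.reverseRecOn_concat, dif_pos hex]
  rw [heq]
  exact hex.choose_spec

theorem consistent_nil (src : Assignment V ℓ) :
    Consistent src (pieces (revealedGraph [])) src := by
  constructor
  · intro C hC
    obtain ⟨v, rfl⟩ := mem_pieces.1 hC
    refine ⟨src v, fun u hu => ?_⟩
    rw [piece_nil, Finset.mem_singleton] at hu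
    rw [hu]
  · intro C hC s hs u hu
    obtain ⟨v, rfl⟩ := mem_pieces.1 hC
    rw [piece_nil] at hs hu
    rw [Finset.mem_singleton] at hu
    subst hu
    by_contra hne
    rw [away, Finset.filter_singleton, if_pos hne, Finset.card_singleton] at hs
    omega

/-- Loads equal `k`, every vertex is at home, and entropies are nonnegative. -/
theorem potential_nil_le (hsrc : IsSourceAssignment k src) {μ : ℝ} (hμ : 0 ≤ μ) :
    potential k μ src (pieces (revealedGraph [])) src ≤ 0 := by
  have h1 : overload k src = 0 := by
    refine Finset.sum_eq_zero fun s _ => max_eq_left ?_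
    have : load src s = k := hsrc s
    rw [this]
    linarith [Nat.cast_nonneg (α := ℝ) k]
  have h2 : ∑ C ∈ pieces (revealedGraph []), credit src src C = 0 :=
    Finset.sum_eq_zero fun C _ => by simp [credit, creditOf]
  have h3 : 0 ≤ ∑ C ∈ pieces (revealedGraph ([] : List (Sym2 V))), entropy src C :=
    Finset.sum_nonneg fun C hC => mul_nonneg (Nat.cast_nonneg _) <|
      Real.logb_nonneg (by norm_num)
        (by exact_mod_cast ((isPartition_pieces _).nonempty C hC).card_pos)
  unfold potential
  rw [h1, h2]
  have := mul_nonneg (show 0 ≤ 1 + μ by linarith) h3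
  push_cast
  linarith

theorem amortizedAlgorithm_spec (hk : 1 ≤ k) (hsrc : IsSourceAssignment k src) {δ : ℝ}
    (hδ : 0 < δ) (σ : List (Sym2 V)) (h : Feasible k src σ) :
    Consistent src (pieces (revealedGraph σ)) (amortizedAlgorithm k δ src σ) ∧
      (∀ s, (load (amortizedAlgorithm k δ src σ) s : ℝ) ≤ (2 + δ) * k) ∧
      k * cost k σ.length ((amortizedAlgorithm k δ src).run σ) +
        potential k (1 + 2 / δ) src (pieces (revealedGraph σ))
          (amortizedAlgorithm k δ src σ) ≤ 0 := by
  induction σ using List.reverseRecOn with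
  | nil =>
    rw [amortizedAlgorithm_nil]
    refine ⟨consistent_nil src, fun s => ?_, ?_⟩
    · have : load src s = k := hsrc s
      rw [this]
      nlinarith [Nat.cast_nonneg (α := ℝ) k]
    · simpa [cost] using potential_nil_le hsrc (show 0 ≤ 1 + 2 / δ by positivity)
  | append_singleton σ e ih =>
    obtain ⟨hc, -, hcost⟩ := ih h.prefix
    obtain ⟨hc', hl', hm'⟩ := amortizedAlgorithm_append hk hsrc hδ h hc
    refine ⟨hc', hl', ?_⟩
    rw [mul_cost hk] at hcost ⊢
    have hlen : (σ ++ [e]).length = σ.length + 1 := by simp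
    have hrun : ∀ t, t ≤ σ.length → (amortizedAlgorithm k δ src).run (σ ++ [e]) t =
        (amortizedAlgorithm k δ src).run σ t := fun t ht => by
      unfold OnlineAlgorithm.run
      rw [List.take_append_of_le_length ht]
    have hlast : (amortizedAlgorithm k δ src).run (σ ++ [e]) (σ.length + 1) =
        amortizedAlgorithm k δ src (σ ++ [e]) := by
      unfold OnlineAlgorithm.run
      rw [← hlen, List.take_length]
    have hprev : (amortizedAlgorithm k δ src).run σ σ.length =
        amortizedAlgorithm k δ src σ := by
      unfold OnlineAlgorithm.run
      rw [List.take_length]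
    rw [hlen, Finset.sum_range_succ, hlast, hrun _ le_rfl, hprev]
    have hsum : ∑ t ∈ Finset.range σ.length,
        (moved ((amortizedAlgorithm k δ src).run (σ ++ [e]) t)
          ((amortizedAlgorithm k δ src).run (σ ++ [e]) (t + 1)) : ℝ) =
        ∑ t ∈ Finset.range σ.length, (moved ((amortizedAlgorithm k δ src).run σ t)
          ((amortizedAlgorithm k δ src).run σ (t + 1)) : ℝ) := by
      refine Finset.sum_congr rfl fun t ht => ?_
      have := Finset.mem_range.1 ht
      rw [hrun t (by omega), hrun (t + 1) (by omega)]
    rw [hsum]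
    linarith

theorem feasible_take (h : Feasible k src σ) (t : ℕ) : Feasible k src (σ.take t) := by
  obtain ⟨f, hf⟩ := h
  have hlen := List.length_take (i := t) (l := σ)
  refine ⟨f, hf.init, fun t' h1 h2 => ?_, fun t' h1 h2 => hf.capacity t' h1 (by omega)⟩
  rw [List.take_take, min_eq_left (by omega)]
  exact hf.cc t' h1 (by omega)

theorem amortizedAlgorithm_serves (hk : 1 ≤ k) (hsrc : IsSourceAssignment k src) {δ : ℝ}
    (hδ : 0 < δ) (h : Feasible k src σ) :
    Serves k (2 + δ) src σ ((amortizedAlgorithm k δ src).run σ) where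
  init := amortizedAlgorithm_nil k δ src
  cc t _ _ := (amortizedAlgorithm_spec hk hsrc hδ _ (feasible_take h t)).1.ccCondition
  capacity t _ _ s := by
    have hk' : (0 : ℝ) < k := by exact_mod_cast hk
    exact (div_le_iff₀ hk').2 ((amortizedAlgorithm_spec hk hsrc hδ _ (feasible_take h t)).2.1 s)

theorem amortizedAlgorithm_cost_le (hk : 1 ≤ k) (hsrc : IsSourceAssignment k src) {δ : ℝ}
    (hδ : 0 < δ) {f : ℕ → Assignment V ℓ} (hf : Serves k 1 src σ f) :
    cost k σ.length ((amortizedAlgorithm k δ src).run σ) ≤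
      (16 * (2 + 2 / δ) / Real.log 2) * Real.log k * cost k σ.length f := by
  have hk' : (0 : ℝ) < k := by exact_mod_cast hk
  have hfeas : Feasible k src σ := ⟨f, hf⟩
  have h1 := (amortizedAlgorithm_spec hk hsrc hδ σ hfeas).2.2
  have h2 := sum_entropy_le (src := src) hk (isPartition_pieces _) (hfeas.card_le hk)
  have h3 := hf.sum_scatter_le hk
  have h4 : 0 ≤ Real.logb 2 k := Real.logb_nonneg (by norm_num) (by exact_mod_cast hk)
  have h5 : 0 ≤ overload k (amortizedAlgorithm k δ src σ) :=
    Finset.sum_nonneg fun s _ => le_max_left _ _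
  have h6 : (0 : ℝ) ≤ (∑ C ∈ pieces (revealedGraph σ),
    credit src (amortizedAlgorithm k δ src σ) C : ℕ) := Nat.cast_nonneg _
  have hδ' : 0 ≤ 2 / δ := by positivity
  have h7 := h2.trans (mul_le_mul_of_nonneg_left h3 (by positivity : 0 ≤ 4 * Real.logb 2 k))
  unfold potential at h1
  have h8 := mul_nonneg (show 0 ≤ 1 + 2 / δ by linarith) h5
  have h9 := mul_nonneg (show 0 ≤ 1 + (1 + 2 / δ) by linarith) h6
  have h10 := mul_le_mul_of_nonneg_left h7 (show 0 ≤ 4 * (1 + (1 + 2 / δ)) by linarith)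
  refine le_of_mul_le_mul_left ?_ hk'
  -- The constant 16 is the entropy coefficient 4 in the potential times the 4 in `weight`; the
  -- division by `log 2` converts `logb 2` to `log`.
  have h11 : 4 * (1 + (1 + 2 / δ)) * (4 * Real.logb 2 k * (k * cost k σ.length f)) =
      k * (16 * (2 + 2 / δ) / Real.log 2 * Real.log k * cost k σ.length f) := by
    rw [← Real.log_div_log]
    ring
  linarith

end Algorithm

end OnlineGraphPartitioning

theorem mainTheorem5 (ε : ℝ) (hε : 1 < ε) :
    ∃ C : ℝ, 0 < C ∧
      ∀ (ℓ k : ℕ), 1 ≤ ℓ → 1 ≤ k →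
        ∀ (V : Type*) [Fintype V] (src : OnlineGraphPartitioning.Assignment V ℓ),
          OnlineGraphPartitioning.IsSourceAssignment k src →
            ∃ A : OnlineGraphPartitioning.OnlineAlgorithm V ℓ,
              OnlineGraphPartitioning.IsCompetitive k (1 + ε) src A (C * Real.log k) := by
  have hδ : 0 < ε - 1 := by linarith
  have hlog : 0 < Real.log 2 := Real.log_pos (by norm_num)
  have hC : 0 < 16 * (2 + 2 / (ε - 1)) / Real.log 2 := by positivity
  refine ⟨_, hC, fun ℓ k _ hk V _ src hsrc =>
    ⟨OnlineGraphPartitioning.amortizedAlgorithm k (ε - 1) src, fun σ hσ => ⟨?_, ?_⟩⟩⟩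
  · have h := OnlineGraphPartitioning.amortizedAlgorithm_serves hk hsrc hδ hσ
    rwa [show 2 + (ε - 1) = 1 + ε by ring] at h
  · have hlogk : 0 ≤ Real.log k := Real.log_nonneg (by exact_mod_cast hk)
    obtain ⟨f₀, hf₀⟩ := hσ
    -- For `k = 1` the ratio is zero and cannot be divided out. Comparison with any one schedule
    -- then shows that the online cost is at most zero.
    rcases (mul_nonneg hC.le hlogk).eq_or_lt with h0 | h0
    · have := OnlineGraphPartitioning.amortizedAlgorithm_cost_le hk hsrc hδ hf₀
      rw [← h0, zero_mul] at this ⊢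
      exact this
    · rw [← div_le_iff₀' h0]
      refine le_csInf ⟨_, f₀, hf₀, rfl⟩ ?_
      rintro c ⟨f, hf, rfl⟩
      rw [div_le_iff₀' h0]
      exact OnlineGraphPartitioning.amortizedAlgorithm_cost_le hk hsrc hδ hf
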